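/- **Definitions.** Let $\mathbb N=\{1,2,\dots\}$. An *excursion* of length $|\varepsilon|=2n+1$ ($n\ge 0$) is a sequence $\varepsilon=(e_0,\dots,e_{2n})\in\{0,1\}^{2n+1}$ with $e_0=0$, $\sum_{j=1}^m(2e_j-1)\ge 0$ for $1\le m<2n$ and $\sum_{j=1}^{2n}(2e_j-1)=0$; $\mathcal E$ is the set of all excursions (of all lengths). For $\varepsilon\in\mathcal E$ let $\eta(x)=e_x$ for $0\le x\le 2n$ and $\eta(x)=0$ for all other $x$, and define $\mathcal W_k(x)\in\{0,1\}$ for $k\in\mathbb N$, $x\ge 0$ by $\mathcal W_k(0)=0$ and $$\mathcal W_k(x)=\mathcal W_k(x-1)+\eta(x)\bigl(1-\mathcal W_k(x-1)\bigr)\prod_{\ell=1}^{k-1}\mathcal W_\ell(x-1)-\bigl(1-\eta(x)\bigr)\mathcal W_k(x-1)\prod_{\ell=1}^{k-1}\bigl(1-\mathcal W_\ell(x-1)\bigr).$$ Put $\eta^\uparrow_k(x)=1$ if $\mathcal W_k(x)>\mathcal W_k(x-1)$ and $\eta^\uparrow_k(x)=0$ otherwise, and $\zeta_k(\varepsilon)=\sum_{x=1}^{|\varepsilon|}\bigl(\eta_k^\uparrow(x)-\eta_{k+1}^\uparrow(x)\bigr)\in\mathbb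 Z_{\ge 0}$ (the number of solitons of size $k$ in $\varepsilon$). For $\alpha=(\alpha_k)_{k\in\mathbb N}\in[0,1)^{\mathbb N}$ let $Z_\alpha=\sum_{\varepsilon\in\mathcal E}\prod_{k\in\mathbb N}\alpha_k^{\zeta_k(\varepsilon)}$ (with $0^0=1$) and let $\mathcal A$ be the set of those $\alpha$ with $Z_\alpha<\infty$. For $\alpha\in\mathcal A$ let $\nu_\alpha(\varepsilon)=Z_\alpha^{-1}\prod_k\alpha_k^{\zeta_k(\varepsilon)}$, a probability measure on $\mathcal E$, and let $$\bar\varepsilon(\alpha)=1+2\sum_{\varepsilon\in\mathcal E}\sum_{k\in\mathbb N}k\,\zeta_k(\varepsilon)\,\nu_\alpha(\varepsilon)$$ be the expected excursion length; $\mathcal A^+=\{\alpha\in\mathcal A:\bar\varepsilon(\alpha)<\infty\}$. Define the shift $\theta$ by $(\theta\alpha)_k=\alpha_{k+1}/(1-\alpha_1)^{2k}$, and let $$F(\alpha)=\frac{2}{1-\alpha_1}-\cfrac{1}{\cfrac{2}{1-(\theta\alpha)_1}-\cfrac{1}{\cfrac{2}{1-(\theta^2\alpha)_1}-\cdots}}$$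 be the limit $\lim_{n\to\infty}F_n(\alpha)$ of the convergents given by $F_0(\alpha)=\frac{2}{1-\alpha_1}$ and $F_{n+1}(\alpha)=\frac{2}{1-\alpha_1}-\frac{1}{F_n(\theta\alpha)}$. **Proposition.** Let $\alpha\in\mathcal A^+$. Then $\theta^\ell\alpha\in\mathcal A^+$ and the continued fraction $F(\theta^\ell\alpha)$ converges for every $\ell\ge 0$, and $$\bar\varepsilon(\alpha)=\prod_{\ell=0}^\infty F(\theta^\ell\alpha),$$ where the infinite product is the limit of the partial products $\prod_{\ell=0}^{N-1}F(\theta^\ell\alpha)$ as $N\to\infty$. -/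

import Mathlib

open Filter Topology

noncomputable section

namespace BoxBall

/-! ### Carrier with seat numbers

A configuration is a function `η : ℕ → ℤ` with values in `{0, 1}`; only the sites `x ≥ 1` matter. -/

/-- `carrier η x k` is the occupation `𝒲_k(η, x) ∈ {0, 1}` of seat No. `k` after site `x`:
the carrier starts empty at `x = 0`; a ball is put into the vacant seat with the smallest number, and
at an empty site the ball sitting at the smallest occupied seat number is put down. -/
def carrier (η : ℕ → ℤ) : ℕ → ℕ+ → ℤ
  | 0, _ => 0
  | x + 1, k =>
      carrier η x k
        + η (x + 1) * (1 - carrier η x k) * ∏ l ∈ Finset.Ico 1 k, carrier η x l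
        - (1 - η (x + 1)) * carrier η x k * ∏ l ∈ Finset.Ico 1 k, (1 - carrier η x l)

/-- `seatUp η k x` is `η^↑_k(x)`: it is `1` if a ball gets into seat No. `k` at site `x`, and `0`
otherwise. -/
def seatUp (η : ℕ → ℤ) (k : ℕ+) (x : ℕ) : ℕ :=
  if carrier η (x - 1) k < carrier η x k then 1 else 0

lemma carrier_succ (η : ℕ → ℤ) (x : ℕ) (k : ℕ+) :
    carrier η (x + 1) k =
      carrier η x k
        + η (x + 1) * (1 - carrier η x k) * ∏ l ∈ Finset.Ico 1 k, carrier η x l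
        - (1 - η (x + 1)) * carrier η x k * ∏ l ∈ Finset.Ico 1 k, (1 - carrier η x l) := rfl

/-! ### Excursions -/

/-- The configuration that carries the finite sequence `e = (e_0, …, e_{L-1})` at the sites
`0, …, L - 1` and is empty elsewhere. -/
def config (e : List (Fin 2)) (x : ℕ) : ℤ := ((e.getD x 0 : Fin 2) : ℕ)

/-- `e = (e_0, …, e_{2n})` is an excursion of length `2n + 1`: `e_0 = 0`, the walk with steps
`2 e_j - 1`, `j = 1, …, 2n`, is never negative, and it ends at `0`. -/
def IsExcursion (e : List (Fin 2)) : Prop :=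
  ∃ n : ℕ, e.length = 2 * n + 1 ∧ config e 0 = 0 ∧
    (∀ m : ℕ, 1 ≤ m → m < 2 * n → 0 ≤ ∑ j ∈ Finset.Icc 1 m, (2 * config e j - 1)) ∧
    ∑ j ∈ Finset.Icc 1 (2 * n), (2 * config e j - 1) = 0

/-- The set `ℰ` of all excursions. -/
abbrev Excursion : Type := {e : List (Fin 2) // IsExcursion e}

/-- The number of times at which a ball gets into seat No. `k` along the sites `1, …, |ε|`
(equivalently, the number of solitons of size at least `k`). -/
def seatCount (ε : Excursion) (k : ℕ+) : ℕ :=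
  ∑ x ∈ Finset.Icc 1 ε.1.length, seatUp (config ε.1) k x

/-- `ζ_k(ε) = ∑_{x = 1}^{|ε|} (η^↑_k(x) - η^↑_{k+1}(x))` where `η` is the configuration of `ε`:
the number of solitons of size `k` in `ε`. The subtraction in `ℕ` never truncates, see
`seatCount_succ_le`. -/
def zeta (ε : Excursion) (k : ℕ+) : ℕ := seatCount ε k - seatCount ε (k + 1)

lemma config_mem (e : List (Fin 2)) (x : ℕ) : config e x = 0 ∨ config e x = 1 := by
  unfold config
  generalize e.getD x 0 = b
  fin_cases b <;> simp

lemma carrier_mem (η : ℕ → ℤ) (hη : ∀ x, η x = 0 ∨ η x = 1) (x : ℕ) :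
    ∀ k, carrier η x k = 0 ∨ carrier η x k = 1 := by
  induction x with
  | zero => intro k; left; rfl
  | succ x ih =>
    intro k
    have h1 : ∀ s : Finset ℕ+, ∏ l ∈ s, carrier η x l = 0 ∨ ∏ l ∈ s, carrier η x l = 1 := by
      intro s
      induction s using Finset.induction_on with
      | empty => simp
      | insert a s ha hs =>
        rw [Finset.prod_insert ha]
        rcases ih a with h | h <;> rcases hs with h' | h' <;> simp [h, h']
    have h2 : ∀ s : Finset ℕ+,
        ∏ l ∈ s, (1 - carrier η x l) = 0 ∨ ∏ l ∈ s, (1 - carrier η x l) = 1 := by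
      intro s
      induction s using Finset.induction_on with
      | empty => simp
      | insert a s ha hs =>
        rw [Finset.prod_insert ha]
        rcases ih a with h | h <;> rcases hs with h' | h' <;> simp [h, h']
    simp only [carrier]
    rcases hη (x + 1) with h | h <;> rcases ih k with h' | h' <;>
      rcases h1 (Finset.Ico 1 k) with h3 | h3 <;> rcases h2 (Finset.Ico 1 k) with h4 | h4 <;>
      simp [h, h', h3, h4]

lemma prod_Ico_succ (f : ℕ+ → ℤ) (k : ℕ+) :
    ∏ l ∈ Finset.Ico 1 (k + 1), f l = (∏ l ∈ Finset.Ico 1 k, f l) * f k := by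
  have h : Finset.Ico 1 (k + 1) = insert k (Finset.Ico 1 k) := by
    ext a
    simp only [Finset.mem_Ico, Finset.mem_insert, PNat.lt_add_one_iff, one_le, true_and]
    exact le_iff_eq_or_lt
  rw [h, Finset.prod_insert (by simp), mul_comm]

/-- Seat No. `k + 1` is never entered more often than seat No. `k`. -/
lemma seatCount_succ_le (ε : Excursion) (k : ℕ+) : seatCount ε (k + 1) ≤ seatCount ε k := by
  have key : ∀ x : ℕ,
      (∑ y ∈ Finset.Icc 1 x, (seatUp (config ε.1) (k + 1) y : ℤ))
        + carrier (config ε.1) x k * (1 - carrier (config ε.1) x (k + 1))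
      ≤ ∑ y ∈ Finset.Icc 1 x, (seatUp (config ε.1) k y : ℤ) := by
    intro x
    induction x with
    | zero => simp [carrier]
    | succ x ih =>
      rw [Finset.sum_Icc_succ_top (by omega), Finset.sum_Icc_succ_top (by omega)]
      have hc := carrier_mem (config ε.1) (config_mem ε.1)
      have hx := hc (x + 1) k
      have hy := hc (x + 1) (k + 1)
      have e1 := carrier_succ (config ε.1) x k
      have e2 := carrier_succ (config ε.1) x (k + 1)
      rw [prod_Ico_succ, prod_Ico_succ] at e2
      have u1 : (seatUp (config ε.1) k (x + 1) : ℤ)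
          = if carrier (config ε.1) x k < carrier (config ε.1) (x + 1) k then 1 else 0 := by
        simp [seatUp]
      have u2 : (seatUp (config ε.1) (k + 1) (x + 1) : ℤ)
          = if carrier (config ε.1) x (k + 1) < carrier (config ε.1) (x + 1) (k + 1)
            then 1 else 0 := by
        simp [seatUp]
      rw [u1, u2]
      clear u1 u2
      generalize (∑ y ∈ Finset.Icc 1 x, (seatUp (config ε.1) (k + 1) y : ℤ)) = S at *
      generalize (∑ y ∈ Finset.Icc 1 x, (seatUp (config ε.1) k y : ℤ)) = T at *
      generalize ∏ l ∈ Finset.Ico 1 k, carrier (config ε.1) x l = P at *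
      generalize ∏ l ∈ Finset.Ico 1 k, (1 - carrier (config ε.1) x l) = Q at *
      rcases config_mem ε.1 (x + 1) with h | h <;> rcases hc x k with h1 | h1 <;>
        rcases hc x (k + 1) with h2 | h2 <;> rcases hx with h3 | h3 <;>
        rcases hy with h4 | h4 <;> simp [h, h1, h2, h3, h4] at e1 e2 ih ⊢ <;> linarith
  have h := key ε.1.length
  have h0 : 0 ≤ carrier (config ε.1) ε.1.length k * (1 - carrier (config ε.1) ε.1.length (k + 1)) := by
    rcases carrier_mem _ (config_mem ε.1) ε.1.length k with h1 | h1 <;>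
      rcases carrier_mem _ (config_mem ε.1) ε.1.length (k + 1) with h2 | h2 <;> simp [h1, h2]
  unfold seatCount
  zify
  linarith

/-! ### The measures `ν_α` and the parameter sets -/

/-- The weight `∏_{k ≥ 1} α_k ^ ζ_k(ε)` (with `0 ^ 0 = 1`; only finitely many factors have a nonzero
exponent). -/
def weight (α : ℕ+ → ℝ) (ε : Excursion) : ℝ := ∏ᶠ k : ℕ+, α k ^ zeta ε k

/-- The partition function `Z_α`. -/
def partitionFn (α : ℕ+ → ℝ) : ℝ := ∑' ε : Excursion, weight α ε

/-- The set `𝒜` of sequences in `[0, 1)` with `Z_α < ∞`. -/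
def paramSet : Set (ℕ+ → ℝ) :=
  {α | (∀ k, 0 ≤ α k ∧ α k < 1) ∧ Summable (weight α)}

/-- The probability mass function `ν_α` on excursions. -/
def nu (α : ℕ+ → ℝ) (ε : Excursion) : ℝ := weight α ε / partitionFn α

/-- `∑_{k ≥ 1} k ζ_k(ε)` (a finite sum). -/
def totalSize (ε : Excursion) : ℝ := ∑ᶠ k : ℕ+, (k : ℝ) * (zeta ε k : ℝ)

/-- The expected excursion length `1 + 2 ∑_ε ∑_k k ζ_k(ε) ν_α(ε)`. -/
def meanLength (α : ℕ+ → ℝ) : ℝ := 1 + 2 * ∑' ε : Excursion, totalSize ε * nu α ε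

/-- The set `𝒜⁺` of `α ∈ 𝒜` with finite expected excursion length. -/
def paramSetPlus : Set (ℕ+ → ℝ) :=
  {α | α ∈ paramSet ∧ Summable fun ε : Excursion => totalSize ε * nu α ε}

/-- The shift `(θα)_k = α_{k+1} / (1 - α_1)^{2k}`. -/
def shift (α : ℕ+ → ℝ) (k : ℕ+) : ℝ := α (k + 1) / (1 - α 1) ^ (2 * (k : ℕ))

/-! ### The continued fraction -/

/-- The convergents of the continued fraction: `F_0(α) = 2 / (1 - α_1)` and
`F_{n+1}(α) = 2 / (1 - α_1) - 1 / F_n(θα)`. -/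
def convergent : ℕ → (ℕ+ → ℝ) → ℝ
  | 0, α => 2 / (1 - α 1)
  | n + 1, α => 2 / (1 - α 1) - 1 / convergent n (shift α)

/-- The value `F(α)` of the infinite continued fraction: the limit of its convergents. -/
def contFrac (α : ℕ+ → ℝ) : ℝ := limUnder atTop fun n => convergent n α

end BoxBall

end

noncomputable section

namespace BoxBall

open scoped ENNReal

/-! ### Words and their reduction -/

/-- `IsDyck h w`: the walk that starts at height `h` and goes up at `true`, down at `false`, stays
nonnegative along `w` and ends at `0`. -/
def IsDyck : ℕ → List Bool → Prop
  | h, [] => h = 0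
  | h, true :: w => IsDyck (h + 1) w
  | 0, false :: _ => False
  | h + 1, false :: w => IsDyck h w

/-- The last letter of `c :: w`. -/
def lastLetter : Bool → List Bool → Bool
  | c, [] => c
  | _, b :: w => lastLetter b w

/-- The letters of `w` that agree with their predecessor, where the first letter is preceded
by `c`. -/
def reduce : Bool → List Bool → List Bool
  | _, [] => []
  | c, b :: w => if b = c then b :: reduce b w else reduce b w

/-- The number of occurrences of `true` in `w` that are preceded by `false`, where the first letter
is preceded by `c`. -/
def ascents : Bool → List Bool → ℕ
  | _, [] => 0
  | c, b :: w => (if c = false ∧ b = true then 1 else 0) + ascents b w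

lemma IsDyck.lastLetter_eq {h : ℕ} {w : List Bool} (hw : IsDyck h w) (c : Bool)
    (hc : c.toNat ≤ h) : lastLetter c w = false := by
  induction w generalizing h c with
  | nil =>
    simp only [IsDyck] at hw
    subst hw
    cases c <;> simp_all [lastLetter]
  | cons b w ih =>
    cases b
    · cases h with
      | zero => exact hw.elim
      | succ h => exact ih hw false (by simp)
    · exact ih hw true (by simp)

lemma isDyck_reduce_iff {c : Bool} {w : List Bool} (hw : lastLetter c w = false) (h : ℕ) :
    IsDyck h (reduce c w) ↔ IsDyck (h + c.toNat) w := by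
  induction w generalizing h c with
  | nil => simp only [lastLetter] at hw; subst hw; simp [reduce]
  | cons b w ih =>
    have ih := fun h => ih (c := b) hw h
    cases b <;> cases c <;> try cases h
    all_goals simp [reduce, IsDyck] at ih ⊢
    all_goals simp [ih]

lemma length_eq_add_length_reduce {w : List Bool} (hw : lastLetter false w = false) :
    w.length = 2 * ascents false w + (reduce false w).length := by
  have key : ∀ (w : List Bool) (c : Bool), lastLetter c w = false →
      w.length = 2 * ascents c w + c.toNat + (reduce c w).length := by
    intro w
    induction w with
    | nil => intro c hc; simp only [lastLetter] at hc; subst hc; simp [ascents, reduce]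
    | cons b w ih =>
      intro c hc
      have := ih b hc
      cases b <;> cases c <;> simp [ascents, reduce, this] <;> omega
  simpa using key w false hw

lemma eq_nil_of_ascents_eq_zero {w : List Bool} (hw : IsDyck 0 w) (h : ascents false w = 0) :
    w = [] := by
  cases w with
  | nil => rfl
  | cons b w => cases b <;> simp [IsDyck, ascents] at hw h

/-! ### The fibres of the reduction -/

/-- `w` preceded by `m` pairs `!c, c` and, if `c ≠ d`, by the letter `d`. -/
def addPairs (c d : Bool) : ℕ → List Bool → List Bool
  | 0, w => if c = d then w else d :: w
  | m + 1, w => (!c) :: c :: addPairs c d m w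

/-- The words ending in `false` (where the empty word counts as `c`) with reduction `u`. -/
abbrev Fibre (c : Bool) (u : List Bool) : Type :=
  {w : List Bool // lastLetter c w = false ∧ reduce c w = u}

lemma lastLetter_addPairs (c d : Bool) (m : ℕ) (w : List Bool) :
    lastLetter c (addPairs c d m w) = lastLetter d w := by
  induction m with
  | zero => simp only [addPairs]; split_ifs with h <;> simp [lastLetter, h]
  | succ m ih => simpa [addPairs, lastLetter] using ih

lemma reduce_addPairs (c d : Bool) (m : ℕ) (w : List Bool) :
    reduce c (addPairs c d m w) = reduce d w := by
  induction m with
  | zero => cases c <;> cases d <;> simp [addPairs, reduce]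
  | succ m ih => cases c <;> simpa [addPairs, reduce] using ih

lemma ascents_addPairs (c d : Bool) (m : ℕ) (w : List Bool) :
    ascents c (addPairs c d m w) = m + (if c = false ∧ d = true then 1 else 0) + ascents d w := by
  induction m with
  | zero => cases c <;> cases d <;> simp [addPairs, ascents]
  | succ m ih => cases c <;> simp [addPairs, ascents, ih] <;> omega

lemma addPairs_nil_injective (c d : Bool) {m m' : ℕ}
    (h : addPairs c d m [] = addPairs c d m' []) : m = m' := by
  induction m generalizing m' with
  | zero => cases m' <;> cases c <;> cases d <;> simp [addPairs] at h ⊢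
  | succ m ih =>
    cases m' with
    | zero => cases c <;> cases d <;> simp [addPairs] at h
    | succ m' => simp only [addPairs, List.cons.injEq, true_and] at h; rw [ih h]

lemma addPairs_cons_injective (c d : Bool) {m m' : ℕ} {w w' : List Bool}
    (h : addPairs c d m (d :: w) = addPairs c d m' (d :: w')) : m = m' ∧ w = w' := by
  induction m generalizing m' with
  | zero => cases m' <;> cases c <;> cases d <;> simp [addPairs] at h ⊢ <;> exact h
  | succ m ih =>
    cases m' with
    | zero => cases c <;> cases d <;> simp [addPairs] at h
    | succ m' =>
      simp only [addPairs, List.cons.injEq, true_and] at h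
      simpa using ih h

lemma exists_addPairs_nil (c : Bool) : ∀ w : List Bool, lastLetter c w = false →
    reduce c w = [] → ∃ m, w = addPairs c false m []
  | [], h, _ => ⟨0, by simp only [lastLetter] at h; simp [addPairs, h]⟩
  | [b], h, h' => ⟨0, by cases b <;> cases c <;> simp [lastLetter, reduce, addPairs] at h h' ⊢⟩
  | b :: b' :: w, h, h' => by
    have hb : b = !c := by cases b <;> cases c <;> simp [reduce] at h' ⊢
    have hb' : b' = c := by subst hb; cases b' <;> cases c <;> simp [reduce] at h' ⊢
    subst hb' hb
    obtain ⟨m, hm⟩ := exists_addPairs_nil b' w h (by cases b' <;> simpa [reduce] using h')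
    exact ⟨m + 1, by rw [addPairs, ← hm]⟩

lemma exists_addPairs_cons (c d : Bool) (u : List Bool) : ∀ w : List Bool,
    lastLetter c w = false → reduce c w = d :: u →
    ∃ m w', w = addPairs c d m (d :: w') ∧ lastLetter d w' = false ∧ reduce d w' = u
  | [], _, h' => by simp [reduce] at h'
  | [b], h, h' => by
    cases b <;> cases c <;> simp [lastLetter, reduce] at h h'
    obtain ⟨rfl, rfl⟩ := h'
    exact ⟨0, [], by simp [addPairs], rfl, rfl⟩
  | b :: b' :: w, h, h' => by
    by_cases hb : b = c
    · subst hb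
      rw [reduce, if_pos rfl] at h'
      obtain ⟨rfl, hu⟩ := List.cons.inj h'
      exact ⟨0, b' :: w, by simp [addPairs], h, hu⟩
    · by_cases hb' : b' = c
      · subst hb'
        obtain ⟨m, w', h1, h2, h3⟩ := exists_addPairs_cons b' d u w h
          (by cases b <;> cases b' <;> simp [reduce] at hb h' ⊢ <;> exact h')
        refine ⟨m + 1, w', ?_, h2, h3⟩
        rw [addPairs, ← h1]
        cases b <;> cases b' <;> simp at hb ⊢
      · have hbb : b' = b := by cases b <;> cases b' <;> cases c <;> simp at hb hb' ⊢
        subst hbb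
        rw [reduce, if_neg hb, reduce, if_pos rfl] at h'
        obtain ⟨rfl, hu⟩ := List.cons.inj h'
        exact ⟨0, w, by simp [addPairs, Ne.symm hb], h, hu⟩

lemma exists_fibre_equiv (c : Bool) (u : List Bool) :
    ∃ e : Fibre c u ≃ (Fin (u.length + 1) → ℕ),
      ∀ w, ascents c w.1 = ascents c u + ∑ i, e w i := by
  induction u generalizing c with
  | nil =>
    let f : ℕ → Fibre c [] := fun m => ⟨addPairs c false m [],
      by rw [lastLetter_addPairs]; rfl, by rw [reduce_addPairs]; rfl⟩
    have hf : Function.Bijective f := by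
      refine ⟨fun m m' h => addPairs_nil_injective c false (congrArg Subtype.val h), ?_⟩
      rintro ⟨w, hw, hw'⟩
      obtain ⟨m, rfl⟩ := exists_addPairs_nil c w hw hw'
      exact ⟨m, rfl⟩
    refine ⟨(Equiv.ofBijective f hf).symm.trans (Equiv.funUnique (Fin 1) ℕ).symm, fun w => ?_⟩
    obtain ⟨m, rfl⟩ := hf.2 w
    have : (Equiv.ofBijective f hf).symm (f m) = m := (Equiv.ofBijective f hf).symm_apply_apply m
    simp only [Equiv.trans_apply, this]
    simp [f, ascents_addPairs, ascents]
  | cons d u ih =>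
    obtain ⟨e, he⟩ := ih d
    let f : ℕ × Fibre d u → Fibre c (d :: u) := fun p => ⟨addPairs c d p.1 (d :: p.2.1),
      by rw [lastLetter_addPairs]; exact p.2.2.1,
      by rw [reduce_addPairs, reduce, if_pos rfl, p.2.2.2]⟩
    have hf : Function.Bijective f := by
      constructor
      · rintro ⟨m, w⟩ ⟨m', w'⟩ h
        obtain ⟨h1, h2⟩ := addPairs_cons_injective c d (congrArg Subtype.val h)
        exact Prod.ext h1 (Subtype.ext h2)
      · rintro ⟨w, hw, hw'⟩
        obtain ⟨m, w', rfl, h2, h3⟩ := exists_addPairs_cons c d u w hw hw'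
        exact ⟨(m, ⟨w', h2, h3⟩), rfl⟩
    refine ⟨(Equiv.ofBijective f hf).symm.trans
      ((Equiv.prodCongr (Equiv.refl ℕ) e).trans (Fin.consEquiv fun _ => ℕ)), fun w => ?_⟩
    obtain ⟨⟨m, w⟩, rfl⟩ := hf.2 w
    have : (Equiv.ofBijective f hf).symm (f (m, w)) = (m, w) :=
      (Equiv.ofBijective f hf).symm_apply_apply _
    simp only [Equiv.trans_apply, this]
    simp [f, ascents_addPairs, ascents, he, Fin.consEquiv, Fin.sum_univ_succ]
    omega

/-! ### The carrier along a word -/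

/-- The occupation of the seats after a letter `b`. -/
def carrierStep (s : ℕ+ → ℤ) (b : Bool) (k : ℕ+) : ℤ :=
  s k + (b.toNat : ℤ) * (1 - s k) * ∏ l ∈ Finset.Ico 1 k, s l
    - (1 - (b.toNat : ℤ)) * s k * ∏ l ∈ Finset.Ico 1 k, (1 - s l)

/-- The number of times at which seat No. `k` is entered along `w`, starting from the occupation
`s`. -/
def entries (k : ℕ+) : (ℕ+ → ℤ) → List Bool → ℕ
  | _, [] => 0
  | s, b :: w => (if s k < carrierStep s b k then 1 else 0) + entries k (carrierStep s b) w

lemma prod_Ico_one_succ (f : ℕ+ → ℤ) (k : ℕ+) :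
    ∏ l ∈ Finset.Ico 1 (k + 1), f l = f 1 * ∏ l ∈ Finset.Ico 1 k, f (l + 1) := by
  induction k using PNat.recOn with
  | one =>
    rw [prod_Ico_succ]
    simp
  | succ k ih => rw [prod_Ico_succ, ih, prod_Ico_succ, mul_assoc]

lemma carrierStep_one (s : ℕ+ → ℤ) (b : Bool) : carrierStep s b 1 = b.toNat := by
  cases b <;> simp [carrierStep]

lemma carrierStep_succ (s : ℕ+ → ℤ) (b c : Bool) (hs : s 1 = c.toNat) (k : ℕ+) :
    carrierStep s b (k + 1) = if b = c then carrierStep (fun l => s (l + 1)) b k else s (k + 1) := by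
  cases b <;> cases c <;> simp [carrierStep, prod_Ico_one_succ, hs]

lemma entries_one (s : ℕ+ → ℤ) (c : Bool) (hs : s 1 = c.toNat) (w : List Bool) :
    entries 1 s w = ascents c w := by
  induction w generalizing s c with
  | nil => rfl
  | cons b w ih =>
    rw [entries, ascents, ih _ b (carrierStep_one s b), carrierStep_one, hs]
    cases b <;> cases c <;> simp

lemma entries_succ (s : ℕ+ → ℤ) (c : Bool) (hs : s 1 = c.toNat) (k : ℕ+) (w : List Bool) :
    entries (k + 1) s w = entries k (fun l => s (l + 1)) (reduce c w) := by
  induction w generalizing s c with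
  | nil => rfl
  | cons b w ih =>
    rw [entries, ih _ b (carrierStep_one s b), carrierStep_succ s b c hs, reduce]
    have h := funext fun l => carrierStep_succ s b c hs l
    rw [h]
    split_ifs <;> simp_all [entries]

lemma sum_seatUp_eq_entries (η : ℕ → ℤ) (k : ℕ+) (w : List Bool) (x : ℕ)
    (h : ∀ i (hi : i < w.length), η (x + 1 + i) = (w[i]).toNat) :
    ∑ y ∈ Finset.Ico x (x + w.length), seatUp η k (y + 1) = entries k (carrier η x) w := by
  induction w generalizing x with
  | nil => simp [entries]
  | cons b w ih =>
    have hs : carrier η (x + 1) = carrierStep (carrier η x) b := by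
      funext l
      have := h 0 (by simp)
      simp only [add_zero, List.getElem_cons_zero] at this
      rw [carrier_succ, carrierStep, this]
    rw [Finset.sum_eq_sum_Ico_succ_bot (by simp), entries, ← hs, List.length_cons,
      ← ih (x + 1) (fun i hi => by
        have := h (i + 1) (by simpa using hi)
        simpa [add_assoc, add_comm, add_left_comm] using this)]
    congr 2
    ring_nf

/-! ### Excursions as Dyck words -/

lemma isDyck_iff_sum (h : ℕ) (w : List Bool) :
    IsDyck h w ↔
      (∀ m ≤ w.length, 0 ≤ (h : ℤ) + ∑ j ∈ Finset.range m, (2 * ((w.getD j false).toNat : ℤ) - 1)) ∧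
      (h : ℤ) + ∑ j ∈ Finset.range w.length, (2 * ((w.getD j false).toNat : ℤ) - 1) = 0 := by
  induction w generalizing h with
  | nil => simp [IsDyck]
  | cons b w ih =>
    have key : ∀ m, (h : ℤ)
        + ∑ j ∈ Finset.range (m + 1), (2 * (((b :: w).getD j false).toNat : ℤ) - 1)
        = (h + (2 * (b.toNat : ℤ) - 1))
          + ∑ j ∈ Finset.range m, (2 * ((w.getD j false).toNat : ℤ) - 1) := by
      intro m
      rw [Finset.sum_range_succ']
      simp only [List.getD_cons_succ, List.getD_cons_zero]
      ring
    rw [List.length_cons, key]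
    have hall : (∀ m ≤ w.length + 1, 0 ≤ (h : ℤ)
        + ∑ j ∈ Finset.range m, (2 * (((b :: w).getD j false).toNat : ℤ) - 1)) ↔
        ∀ m ≤ w.length, 0 ≤ (h + (2 * (b.toNat : ℤ) - 1))
          + ∑ j ∈ Finset.range m, (2 * ((w.getD j false).toNat : ℤ) - 1) := by
      constructor
      · intro H m hm
        rw [← key]
        exact H (m + 1) (by omega)
      · intro H m hm
        cases m with
        | zero => simp
        | succ m => rw [key]; exact H m (by omega)
    rw [hall]
    cases b
    · cases h with
      | zero =>
        simp only [IsDyck, false_iff]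
        rintro ⟨H, -⟩
        simpa using H 0 (by simp)
      | succ h =>
        rw [IsDyck, ih]
        simp
    · rw [IsDyck, ih]
      have : ((h + 1 : ℕ) : ℤ) = h + (2 * ((true.toNat : ℕ) : ℤ) - 1) := by simp
      rw [this]

/-- The sequence `0, w` in `{0, 1}`. -/
def bits (w : List Bool) : List (Fin 2) := 0 :: w.map fun b => bif b then 1 else 0

lemma config_bits_succ (w : List Bool) (i : ℕ) :
    config (bits w) (i + 1) = ((w.getD i false).toNat : ℤ) := by
  unfold config bits
  rw [List.getD_cons_succ]
  by_cases hi : i < w.length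
  · rw [List.getD_eq_getElem _ _ (by simpa using hi), List.getD_eq_getElem _ _ hi, List.getElem_map]
    cases w[i] <;> rfl
  · rw [List.getD_eq_default _ _ (by simpa using hi), List.getD_eq_default _ _ (by simpa using hi)]
    rfl

lemma sum_config_bits (w : List Bool) (m : ℕ) :
    ∑ j ∈ Finset.Icc 1 m, (2 * config (bits w) j - 1)
      = ∑ j ∈ Finset.range m, (2 * ((w.getD j false).toNat : ℤ) - 1) := by
  induction m with
  | zero => simp
  | succ m ih => rw [Finset.sum_Icc_succ_top (by omega), Finset.sum_range_succ, ih, config_bits_succ]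

lemma length_bits (w : List Bool) : (bits w).length = w.length + 1 := by simp [bits]

lemma bits_injective : Function.Injective bits := by
  intro w w' h
  refine List.map_injective_iff.2 ?_ (List.cons.inj h).2
  intro b b' hb
  cases b <;> cases b' <;> simp_all

lemma exists_bits {e : List (Fin 2)} (he : IsExcursion e) : ∃ w, e = bits w := by
  obtain ⟨n, hn, h0, -⟩ := he
  cases e with
  | nil => simp at hn
  | cons a t =>
    have ha : a = 0 := by
      simp only [config, List.getD_cons_zero] at h0
      exact Fin.ext (Nat.cast_eq_zero.1 h0)
    refine ⟨t.map fun i => decide (i = 1), ?_⟩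
    rw [ha, bits, List.map_map]
    congr 1
    conv_lhs => rw [← List.map_id t]
    refine List.map_congr_left fun i _ => ?_
    fin_cases i <;> rfl

lemma IsDyck.length_even {w : List Bool} (hw : IsDyck 0 w) : ∃ n, w.length = 2 * n := by
  have h := ((isDyck_iff_sum 0 w).1 hw).2
  rw [Finset.sum_sub_distrib, ← Finset.mul_sum] at h
  simp only [Finset.sum_const, Finset.card_range, nsmul_eq_mul, mul_one, ← Nat.cast_sum] at h
  exact ⟨∑ i ∈ Finset.range w.length, (w.getD i false).toNat, by push_cast at h; zify; linarith⟩

lemma isExcursion_bits_iff (w : List Bool) : IsExcursion (bits w) ↔ IsDyck 0 w := by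
  constructor
  · rintro ⟨n, hn, -, h1, h2⟩
    have hl : w.length = 2 * n := by rw [length_bits] at hn; omega
    rw [isDyck_iff_sum]
    simp only [sum_config_bits] at h1 h2
    rw [hl]
    refine ⟨fun m hm => ?_, by simpa using h2⟩
    rcases Nat.eq_zero_or_pos m with rfl | h0
    · simp
    · rcases hm.eq_or_lt with rfl | hlt
      · rw [h2]
        simp
      · simpa using h1 m h0 hlt
  · intro hw
    obtain ⟨n, hn⟩ := hw.length_even
    rw [isDyck_iff_sum, hn] at hw
    refine ⟨n, by rw [length_bits, hn], rfl, fun m _ hm => ?_, ?_⟩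
    · rw [sum_config_bits]
      simpa using hw.1 m hm.le
    · rw [sum_config_bits]
      simpa using hw.2

lemma exists_word (ε : Excursion) : ∃ w, IsDyck 0 w ∧ ε.1 = bits w := by
  obtain ⟨w, hw⟩ := exists_bits ε.2
  exact ⟨w, (isExcursion_bits_iff w).1 (hw ▸ ε.2), hw⟩

/-- The letters of an excursion after the initial `0`. -/
def word (ε : Excursion) : List Bool := (exists_word ε).choose

lemma isDyck_word (ε : Excursion) : IsDyck 0 (word ε) := (exists_word ε).choose_spec.1

lemma bits_word (ε : Excursion) : bits (word ε) = ε.1 := (exists_word ε).choose_spec.2.symm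

lemma word_injective : Function.Injective word := fun ε ε' h => by
  rw [Subtype.ext_iff, ← bits_word, h, bits_word]

/-- The excursion with a given Dyck word. -/
def ofWord (w : List Bool) (hw : IsDyck 0 w) : Excursion := ⟨bits w, (isExcursion_bits_iff w).2 hw⟩

lemma word_ofWord (w : List Bool) (hw : IsDyck 0 w) : word (ofWord w hw) = w :=
  bits_injective (bits_word _)

lemma lastLetter_word (ε : Excursion) : lastLetter false (word ε) = false :=
  (isDyck_word ε).lastLetter_eq false (by simp)

/-! ### Removal of the solitons of size one -/

/-- The excursion obtained by deleting all letters that differ from their predecessor; it lowers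
the size of each soliton by one. -/
def shrink (ε : Excursion) : Excursion :=
  ofWord (reduce false (word ε))
    ((isDyck_reduce_iff (lastLetter_word ε) 0).2 (by simpa using isDyck_word ε))

lemma word_shrink (ε : Excursion) : word (shrink ε) = reduce false (word ε) := word_ofWord _ _

/-- The number of balls of an excursion. -/
def half (ε : Excursion) : ℕ := (word ε).length / 2

lemma length_word (ε : Excursion) : (word ε).length = 2 * half ε := by
  obtain ⟨n, hn⟩ := (isDyck_word ε).length_even
  rw [half, hn]
  omega

lemma seatCount_eq_entries (ε : Excursion) (k : ℕ+) :
    seatCount ε k = entries k (fun _ => 0) (word ε) := by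
  have hlast : seatUp (config (bits (word ε))) k ((word ε).length + 1) = 0 := by
    have hc := carrier_mem _ (config_mem (bits (word ε)))
    have h0 : config (bits (word ε)) ((word ε).length + 1) = 0 := by
      rw [config_bits_succ, List.getD_eq_default _ _ le_rfl]
      rfl
    rw [seatUp, if_neg]
    rw [Nat.add_sub_cancel, carrier_succ, h0, not_lt]
    have : 0 ≤ ∏ l ∈ Finset.Ico 1 k, (1 - carrier (config (bits (word ε))) (word ε).length l) :=
      Finset.prod_nonneg fun l _ => by rcases hc (word ε).length l with h | h <;> simp [h]
    rcases hc (word ε).length k with h | h <;> simp [h, this]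
  have hsum := sum_seatUp_eq_entries (config (bits (word ε))) k (word ε) 0 (fun i hi => by
    rw [show 0 + 1 + i = i + 1 by ring, config_bits_succ, List.getD_eq_getElem _ _ hi])
  rw [seatCount, ← bits_word ε, length_bits, Finset.sum_Icc_succ_top (by omega), hlast, add_zero]
  refine Eq.trans ?_ hsum
  rw [zero_add, ← Finset.range_eq_Ico, Finset.range_eq_Ico,
    Finset.sum_Ico_add' (fun y => seatUp (config (bits (word ε))) k y) 0 _ 1]
  congr 1

lemma seatCount_one (ε : Excursion) : seatCount ε 1 = ascents false (word ε) := by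
  rw [seatCount_eq_entries, entries_one _ false (by simp)]

lemma seatCount_succ (ε : Excursion) (k : ℕ+) : seatCount ε (k + 1) = seatCount (shrink ε) k := by
  rw [seatCount_eq_entries, seatCount_eq_entries, entries_succ _ false (by simp), word_shrink]

lemma zeta_succ (ε : Excursion) (k : ℕ+) : zeta ε (k + 1) = zeta (shrink ε) k := by
  rw [zeta, zeta, seatCount_succ, seatCount_succ]

lemma seatCount_one_eq (ε : Excursion) : seatCount ε 1 = zeta ε 1 + seatCount (shrink ε) 1 := by
  have := seatCount_succ_le ε 1
  rw [zeta, ← seatCount_succ]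
  omega

lemma half_eq (ε : Excursion) : half ε = seatCount ε 1 + half (shrink ε) := by
  have h := length_eq_add_length_reduce (lastLetter_word ε)
  rw [← word_shrink, length_word, length_word, ← seatCount_one] at h
  omega

lemma half_eq_zero_of_seatCount {ε : Excursion} (h : seatCount ε 1 = 0) : half ε = 0 := by
  rw [seatCount_one] at h
  simp [half, eq_nil_of_ascents_eq_zero (isDyck_word ε) h]

lemma half_shrink_le (ε : Excursion) : half (shrink ε) ≤ half ε - 1 := by
  have h := half_eq ε
  have h' := @half_eq_zero_of_seatCount ε
  omega

lemma seatCount_eq_zero (ε : Excursion) (k : ℕ+) (hk : half ε < k) : seatCount ε k = 0 := by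
  induction k using PNat.recOn generalizing ε with
  | one =>
    have h := half_eq ε
    simp only [PNat.one_coe, Nat.lt_one_iff] at hk
    omega
  | succ k ih =>
    rw [seatCount_succ]
    apply ih
    have := half_shrink_le ε
    have := k.pos
    rw [PNat.add_coe, PNat.one_coe] at hk
    omega

lemma zeta_eq_zero (ε : Excursion) (k : ℕ+) (hk : half ε < k) : zeta ε k = 0 := by
  rw [zeta, seatCount_eq_zero ε k hk, Nat.zero_sub]

/-- The excursions with a given image under `shrink` correspond to the ways to insert pairs of
letters behind each of its letters. -/
lemma exists_shrink_fibre_equiv (ε' : Excursion) :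
    ∃ e : {ε // shrink ε = ε'} ≃ (Fin (2 * half ε' + 1) → ℕ),
      ∀ ε, zeta ε.1 1 = ∑ i, e ε i := by
  have hfib := exists_fibre_equiv false (word ε')
  rw [length_word] at hfib
  obtain ⟨e, he⟩ := hfib
  have hD : ∀ w : Fibre false (word ε'), IsDyck 0 w.1 := fun w => by
    have := (isDyck_reduce_iff w.2.1 0).1 (by rw [w.2.2]; exact isDyck_word ε')
    simpa using this
  let f : {ε // shrink ε = ε'} ≃ Fibre false (word ε') :=
    { toFun := fun ε => ⟨word ε.1, lastLetter_word _, by rw [← word_shrink, ε.2]⟩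
      invFun := fun w => ⟨ofWord w.1 (hD w),
        word_injective (by rw [word_shrink, word_ofWord, w.2.2])⟩
      left_inv := fun ε => Subtype.ext (word_injective (word_ofWord _ (isDyck_word _)))
      right_inv := fun w => Subtype.ext (word_ofWord _ (hD w)) }
  refine ⟨f.trans e, fun ε => ?_⟩
  have h := he (f ε)
  have h1 := seatCount_one_eq ε.1
  rw [ε.2, seatCount_one, seatCount_one] at h1
  have h2 : (f ε).1 = word ε.1 := rfl
  rw [h2] at h
  rw [Equiv.trans_apply]
  omega

/-! ### Finite products over the soliton sizes -/

lemma finite_le_half (ε : Excursion) : {k : ℕ+ | (k : ℕ) ≤ half ε}.Finite :=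
  (Set.finite_Iic (half ε)).preimage PNat.coe_injective.injOn

@[to_additive]
lemma finprod_pnat_eq {M : Type*} [CommMonoid M] {f : ℕ+ → M} (hf : f.mulSupport.Finite) :
    ∏ᶠ k, f k = f 1 * ∏ᶠ k : ℕ+, f (k + 1) := by
  rw [← mul_finprod_cond_ne 1 hf, ← finprod_mem_range (g := fun k : ℕ+ => k + 1)
    (add_left_injective 1)]
  congr 1
  refine finprod_congr fun i => finprod_congr_Prop (propext ?_) fun _ => rfl
  constructor
  · intro h
    obtain ⟨k, rfl⟩ := PNat.exists_eq_succ_of_ne_one h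
    exact ⟨k, rfl⟩
  · rintro ⟨k, rfl⟩ h
    have := congrArg PNat.val h
    have hk := k.pos
    simp only [PNat.val_ofNat] at this
    erw [PNat.add_coe] at this
    simp at this

lemma mulSupport_pow_zeta_finite (α : ℕ+ → ℝ) (ε : Excursion) :
    (Function.mulSupport fun k => α k ^ zeta ε k).Finite := by
  refine (finite_le_half ε).subset fun k hk => ?_
  by_contra h
  exact hk (by simp [zeta_eq_zero ε k (not_le.1 h)])

lemma weight_eq (α : ℕ+ → ℝ) (ε : Excursion) :
    weight α ε = α 1 ^ zeta ε 1 * weight (fun k => α (k + 1)) (shrink ε) := by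
  rw [weight, finprod_pnat_eq (mulSupport_pow_zeta_finite α ε)]
  simp only [zeta_succ]
  rfl

lemma weight_nonneg {α : ℕ+ → ℝ} (hα : ∀ k, 0 ≤ α k) (ε : Excursion) : 0 ≤ weight α ε :=
  finprod_nonneg fun k => pow_nonneg (hα k) _

lemma zeta_eq_zero_of_half {ε : Excursion} (h : half ε = 0) (k : ℕ+) : zeta ε k = 0 :=
  zeta_eq_zero ε k (by rw [h]; exact k.pos)

lemma weight_of_half_eq_zero (α : ℕ+ → ℝ) {ε : Excursion} (h : half ε = 0) : weight α ε = 1 := by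
  simp [weight, zeta_eq_zero_of_half h]

lemma half_shrink_lt {ε : Excursion} (h : half ε ≠ 0) : half (shrink ε) < half ε := by
  have := half_shrink_le ε
  omega

lemma weight_mul_pow (α : ℕ+ → ℝ) (d c : ℝ) (ε : Excursion) :
    weight (fun k => α k * (d * c ^ (k : ℕ))) ε
      = weight α ε * (d ^ seatCount ε 1 * c ^ half ε) := by
  induction hn : half ε using Nat.strong_induction_on generalizing ε α d with
  | _ n ih =>
    subst hn
    have hh := half_eq ε
    by_cases h0 : half ε = 0
    · have : seatCount ε 1 = 0 := by omega
      simp [weight_of_half_eq_zero _ h0, h0, this]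
    · have h1 := ih _ (half_shrink_lt h0) (fun k => α (k + 1)) (d * c) (shrink ε) rfl
      rw [weight_eq, weight_eq α]
      have h2 : (fun k : ℕ+ => α (k + 1) * (d * c ^ ((k + 1 : ℕ+) : ℕ)))
          = fun k => α (k + 1) * (d * c * c ^ (k : ℕ)) := by
        funext k
        rw [PNat.add_coe, PNat.one_coe, pow_succ]
        ring
      rw [h2, h1, hh, seatCount_one_eq ε]
      simp only [PNat.one_coe, pow_one, mul_pow, pow_add]
      ring

lemma finsum_add_mul_zeta (d : ℝ) (ε : Excursion) :
    ∑ᶠ k : ℕ+, (d + (k : ℝ)) * (zeta ε k : ℝ) = d * seatCount ε 1 + half ε := by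
  induction hn : half ε using Nat.strong_induction_on generalizing ε d with
  | _ n ih =>
    subst hn
    have hh := half_eq ε
    by_cases h0 : half ε = 0
    · have : seatCount ε 1 = 0 := by omega
      simp [zeta_eq_zero_of_half h0, h0, this]
    · have h1 := ih _ (half_shrink_lt h0) (d + 1) (shrink ε) rfl
      have hf : (Function.support fun k : ℕ+ => (d + (k : ℝ)) * (zeta ε k : ℝ)).Finite := by
        refine (finite_le_half ε).subset fun k hk => ?_
        by_contra h
        exact hk (by simp [zeta_eq_zero ε k (not_le.1 h)])
      rw [finsum_pnat_eq hf]
      have h3 : (fun k : ℕ+ => (d + ((k + 1 : ℕ+) : ℝ)) * (zeta ε (k + 1) : ℝ))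
          = fun k : ℕ+ => (d + 1 + (k : ℝ)) * (zeta (shrink ε) k : ℝ) := by
        funext k
        rw [zeta_succ, PNat.add_coe, PNat.one_coe]
        push_cast
        ring
      rw [h3, h1, hh, seatCount_one_eq ε]
      push_cast
      ring

lemma totalSize_eq (ε : Excursion) : totalSize ε = half ε := by
  simpa [totalSize] using finsum_add_mul_zeta 0 ε

lemma weight_shift (α : ℕ+ → ℝ) (ε : Excursion) :
    weight (shift α) ε = weight (fun k => α (k + 1)) ε * (1 - α 1)⁻¹ ^ (2 * half ε) := by
  have h := weight_mul_pow (fun k => α (k + 1)) 1 ((1 - α 1)⁻¹ ^ 2) ε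
  rw [one_pow, one_mul, ← pow_mul] at h
  rw [← h]
  congr 1
  funext k
  rw [shift, one_mul, ← pow_mul, inv_pow, div_eq_mul_inv]

/-! ### Geometric sums over several indices -/

lemma tsum_fin_succ_arrow {L : ℕ} (F : (Fin (L + 1) → ℕ) → ℝ≥0∞) :
    ∑' m, F m = ∑' (a : ℕ) (m : Fin L → ℕ), F (Fin.cons a m) := by
  rw [← (Fin.consEquiv fun _ => ℕ).tsum_eq]
  exact ENNReal.tsum_prod (f := fun a m => F (Fin.cons a m))

lemma tsum_pow_sum (x : ℝ≥0∞) (L : ℕ) :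
    ∑' m : Fin L → ℕ, x ^ ∑ i, m i = (∑' n : ℕ, x ^ n) ^ L := by
  induction L with
  | zero => simp
  | succ L ih =>
    rw [tsum_fin_succ_arrow]
    simp only [Fin.sum_univ_succ, Fin.cons_zero, Fin.cons_succ,
      pow_add, ENNReal.tsum_mul_left, ENNReal.tsum_mul_right, ih]
    ring

lemma tsum_sum_mul_pow_sum (x : ℝ≥0∞) (L : ℕ) :
    ∑' m : Fin (L + 1) → ℕ, ((∑ i, m i : ℕ) : ℝ≥0∞) * x ^ ∑ i, m i
      = (L + 1) * (∑' n : ℕ, (n : ℝ≥0∞) * x ^ n) * (∑' n : ℕ, x ^ n) ^ L := by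
  have step : ∀ L : ℕ, ∑' m : Fin (L + 1) → ℕ, ((∑ i, m i : ℕ) : ℝ≥0∞) * x ^ ∑ i, m i
      = (∑' n : ℕ, (n : ℝ≥0∞) * x ^ n) * (∑' n : ℕ, x ^ n) ^ L
        + (∑' n : ℕ, x ^ n) * ∑' m : Fin L → ℕ, ((∑ i, m i : ℕ) : ℝ≥0∞) * x ^ ∑ i, m i := by
    intro L
    rw [tsum_fin_succ_arrow]
    have : ∀ (a : ℕ) (m : Fin L → ℕ),
        ((∑ i, (Fin.cons a m : Fin (L + 1) → ℕ) i : ℕ) : ℝ≥0∞)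
            * x ^ ∑ i, (Fin.cons a m : Fin (L + 1) → ℕ) i
          = ((a : ℝ≥0∞) * x ^ a) * x ^ ∑ i, m i
            + x ^ a * (((∑ i, m i : ℕ) : ℝ≥0∞) * x ^ ∑ i, m i) := by
      intro a m
      simp only [Fin.sum_univ_succ, Fin.cons_zero, Fin.cons_succ,
        pow_add]
      push_cast
      ring
    simp only [this, ENNReal.tsum_add, ENNReal.tsum_mul_left, ENNReal.tsum_mul_right, tsum_pow_sum]
  induction L with
  | zero => rw [step]; simp
  | succ L ih =>
    rw [step, ih]
    push_cast
    ring

/-! ### Weighted sums over excursions -/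

/-- The sum of `F` over all excursions with the weights given by `α`. -/
def weightedSum (α : ℕ+ → ℝ) (F : Excursion → ℝ≥0∞) : ℝ≥0∞ :=
  ∑' ε, ENNReal.ofReal (weight α ε) * F ε

lemma weightedSum_eq_tsum_fibre {α : ℕ+ → ℝ} (hα : ∀ k, 0 ≤ α k)
    (F : Excursion → ℕ → ℝ≥0∞) :
    weightedSum α (fun ε => F (shrink ε) (zeta ε 1))
      = ∑' ε, ENNReal.ofReal (weight (fun k => α (k + 1)) ε)
          * ∑' m : Fin (2 * half ε + 1) → ℕ, F ε (∑ i, m i) * ENNReal.ofReal (α 1) ^ ∑ i, m i := by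
  rw [weightedSum, ← (Equiv.sigmaFiberEquiv shrink).tsum_eq, ENNReal.tsum_sigma']
  refine tsum_congr fun ε' => ?_
  obtain ⟨e, he⟩ := exists_shrink_fibre_equiv ε'
  rw [← e.tsum_eq, ← ENNReal.tsum_mul_left]
  refine tsum_congr fun ε => ?_
  change ENNReal.ofReal (weight α ε.1) * F (shrink ε.1) (zeta ε.1 1) = _
  rw [weight_eq, ε.2, he, ENNReal.ofReal_mul (pow_nonneg (hα 1) _), ENNReal.ofReal_pow (hα 1)]
  ring

lemma tsum_ofReal_pow {x : ℝ} (h0 : 0 ≤ x) (h1 : x < 1) :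
    ∑' n : ℕ, ENNReal.ofReal x ^ n = ENNReal.ofReal (1 - x)⁻¹ := by
  rw [ENNReal.tsum_geometric, ENNReal.ofReal_inv_of_pos (by linarith),
    ENNReal.ofReal_sub _ h0, ENNReal.ofReal_one]

lemma tsum_mul_ofReal_pow {x : ℝ} (h0 : 0 ≤ x) (h1 : x < 1) :
    ∑' n : ℕ, (n : ℝ≥0∞) * ENNReal.ofReal x ^ n = ENNReal.ofReal (x / (1 - x) ^ 2) := by
  have h := hasSum_coe_mul_geometric_of_norm_lt_one (r := x)
    (by rwa [Real.norm_eq_abs, abs_of_nonneg h0])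
  rw [← h.tsum_eq, ENNReal.ofReal_tsum_of_nonneg (fun n => by positivity) h.summable]
  refine tsum_congr fun n => ?_
  rw [ENNReal.ofReal_mul (by positivity), ENNReal.ofReal_natCast, ENNReal.ofReal_pow h0]

lemma ofReal_weight_shift {α : ℕ+ → ℝ} (hα : ∀ k, 0 ≤ α k) (h1 : α 1 < 1) (ε : Excursion) :
    ENNReal.ofReal (weight (shift α) ε)
      = ENNReal.ofReal (weight (fun k => α (k + 1)) ε)
        * ENNReal.ofReal (1 - α 1)⁻¹ ^ (2 * half ε) := by
  have : 0 ≤ (1 - α 1)⁻¹ := inv_nonneg.2 (by linarith)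
  rw [weight_shift, ENNReal.ofReal_mul (weight_nonneg (fun k => hα _) ε), ENNReal.ofReal_pow this]

lemma weightedSum_comp_shrink {α : ℕ+ → ℝ} (hα : ∀ k, 0 ≤ α k) (h1 : α 1 < 1)
    (F : Excursion → ℝ≥0∞) :
    weightedSum α (fun ε => F (shrink ε))
      = ENNReal.ofReal (1 - α 1)⁻¹ * weightedSum (shift α) F := by
  rw [weightedSum_eq_tsum_fibre hα (fun ε _ => F ε), weightedSum, ← ENNReal.tsum_mul_left]
  refine tsum_congr fun ε => ?_
  rw [ENNReal.tsum_mul_left, tsum_pow_sum, tsum_ofReal_pow (hα 1) h1, ofReal_weight_shift hα h1]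
  ring

lemma weightedSum_zeta_one {α : ℕ+ → ℝ} (hα : ∀ k, 0 ≤ α k) (h1 : α 1 < 1) :
    weightedSum α (fun ε => (zeta ε 1 : ℝ≥0∞))
      = ENNReal.ofReal (α 1 / (1 - α 1) ^ 2)
        * weightedSum (shift α) (fun ε => 2 * (half ε : ℝ≥0∞) + 1) := by
  rw [weightedSum_eq_tsum_fibre hα (fun _ n => (n : ℝ≥0∞)), weightedSum, ← ENNReal.tsum_mul_left]
  refine tsum_congr fun ε => ?_
  rw [tsum_sum_mul_pow_sum, tsum_ofReal_pow (hα 1) h1, tsum_mul_ofReal_pow (hα 1) h1,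
    ofReal_weight_shift hα h1]
  push_cast
  ring

lemma weightedSum_add (α : ℕ+ → ℝ) (F G : Excursion → ℝ≥0∞) :
    weightedSum α (fun ε => F ε + G ε) = weightedSum α F + weightedSum α G := by
  simp only [weightedSum, mul_add, ENNReal.tsum_add]

lemma weightedSum_const_mul (α : ℕ+ → ℝ) (c : ℝ≥0∞) (F : Excursion → ℝ≥0∞) :
    weightedSum α (fun ε => c * F ε) = c * weightedSum α F := by
  simp only [weightedSum, ← ENNReal.tsum_mul_left]
  exact tsum_congr fun ε => by ring

lemma weightedSum_mono (α : ℕ+ → ℝ) {F G : Excursion → ℝ≥0∞} (h : ∀ ε, F ε ≤ G ε) :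
    weightedSum α F ≤ weightedSum α G :=
  ENNReal.tsum_le_tsum fun ε => mul_le_mul_right (h ε) _

lemma toReal_weightedSum_natCast {α : ℕ+ → ℝ} (hα : ∀ k, 0 ≤ α k) (f : Excursion → ℕ) :
    (weightedSum α fun ε => (f ε : ℝ≥0∞)).toReal = ∑' ε, weight α ε * f ε := by
  rw [weightedSum, ENNReal.tsum_toReal_eq fun ε => by finiteness]
  refine tsum_congr fun ε => ?_
  rw [ENNReal.toReal_mul, ENNReal.toReal_ofReal (weight_nonneg hα ε), ENNReal.toReal_natCast]

lemma summable_weight_mul_iff {α : ℕ+ → ℝ} (hα : ∀ k, 0 ≤ α k) (f : Excursion → ℕ) :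
    (Summable fun ε => weight α ε * f ε) ↔ weightedSum α (fun ε => (f ε : ℝ≥0∞)) ≠ ∞ := by
  have h : ∀ ε, ENNReal.ofReal (weight α ε * f ε) = ENNReal.ofReal (weight α ε) * f ε := fun ε => by
    rw [ENNReal.ofReal_mul (weight_nonneg hα ε), ENNReal.ofReal_natCast]
  simp only [weightedSum, ← h]
  refine ⟨fun hs => hs.tsum_ofReal_ne_top, fun hs => ?_⟩
  have := ENNReal.summable_toReal hs
  simpa only [ENNReal.toReal_ofReal (mul_nonneg (weight_nonneg hα _) (Nat.cast_nonneg _))] using this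

/-! ### Single solitons and the range of the parameters -/

lemma exists_shrink_eq (ε' : Excursion) (n : ℕ) : ∃ ε, shrink ε = ε' ∧ zeta ε 1 = n := by
  obtain ⟨e, he⟩ := exists_shrink_fibre_equiv ε'
  refine ⟨(e.symm (Pi.single 0 n)).1, (e.symm (Pi.single 0 n)).2, ?_⟩
  rw [he, Equiv.apply_symm_apply, Finset.sum_pi_single']
  simp

lemma exists_half_eq_zero : ∃ ε : Excursion, half ε = 0 :=
  have h : IsDyck 0 [] := rfl
  ⟨ofWord [] h, by simp [half, word_ofWord [] h]⟩

lemma exists_zeta_eq_single (k : ℕ+) (n : ℕ) :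
    ∃ ε : Excursion, zeta ε k = n ∧ ∀ j, j ≠ k → zeta ε j = 0 := by
  induction k using PNat.recOn with
  | one =>
    obtain ⟨ε', h'⟩ := exists_half_eq_zero
    obtain ⟨ε, h, h1⟩ := exists_shrink_eq ε' n
    refine ⟨ε, h1, fun j hj => ?_⟩
    obtain ⟨j, rfl⟩ := PNat.exists_eq_succ_of_ne_one hj
    rw [zeta_succ, h, zeta_eq_zero_of_half h']
  | succ k ih =>
    obtain ⟨ε', h', h''⟩ := ih
    obtain ⟨ε, h, h1⟩ := exists_shrink_eq ε' 0
    refine ⟨ε, by rw [zeta_succ, h, h'], fun j hj => ?_⟩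
    by_cases hj1 : j = 1
    · rw [hj1, h1]
    · obtain ⟨j, rfl⟩ := PNat.exists_eq_succ_of_ne_one hj1
      rw [zeta_succ, h, h'']
      rintro rfl
      exact hj rfl

lemma lt_one_of_summable_weight {α : ℕ+ → ℝ} (hs : Summable (weight α))
    (k : ℕ+) : α k < 1 := by
  choose f hf hf' using exists_zeta_eq_single k
  have hinj : Function.Injective f := fun m n h => by rw [← hf m, h, hf n]
  have hw : weight α ∘ f = fun n => α k ^ n := by
    funext n
    rw [Function.comp_apply, weight, finprod_eq_single _ k (fun j hj => by rw [hf' n j hj, pow_zero]),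
      hf]
  have := hs.comp_injective hinj
  rw [hw, summable_geometric_iff_norm_lt_one] at this
  exact (le_abs_self _).trans_lt this

lemma one_le_weightedSum_one (α : ℕ+ → ℝ) : 1 ≤ weightedSum α 1 := by
  obtain ⟨ε, hε⟩ := exists_half_eq_zero
  refine le_trans ?_ (ENNReal.le_tsum ε)
  simp [weight_of_half_eq_zero α hε]

lemma partitionFn_eq {α : ℕ+ → ℝ} (hα : ∀ k, 0 ≤ α k) :
    partitionFn α = (weightedSum α 1).toReal := by
  have := toReal_weightedSum_natCast hα fun _ => 1
  simp only [Nat.cast_one, mul_one] at this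
  exact this.symm

lemma summable_weight_iff {α : ℕ+ → ℝ} (hα : ∀ k, 0 ≤ α k) :
    Summable (weight α) ↔ weightedSum α 1 ≠ ∞ := by
  have := summable_weight_mul_iff hα fun _ => 1
  simp only [Nat.cast_one, mul_one] at this
  exact this

lemma mem_paramSetPlus_iff {α : ℕ+ → ℝ} :
    α ∈ paramSetPlus ↔ (∀ k, 0 ≤ α k) ∧ weightedSum α 1 ≠ ∞ ∧
      weightedSum α (fun ε => (half ε : ℝ≥0∞)) ≠ ∞ := by
  have key : (∀ k, 0 ≤ α k) → weightedSum α 1 ≠ ∞ →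
      ((Summable fun ε : Excursion => totalSize ε * nu α ε) ↔
        weightedSum α (fun ε => (half ε : ℝ≥0∞)) ≠ ∞) := by
    intro hα hZ
    have hpos : (partitionFn α)⁻¹ ≠ 0 := by
      rw [partitionFn_eq hα]
      exact inv_ne_zero (ENNReal.toReal_ne_zero.2
        ⟨(zero_lt_one.trans_le (one_le_weightedSum_one α)).ne', hZ⟩)
    rw [← summable_weight_mul_iff hα]
    refine Iff.trans ?_ (summable_mul_right_iff hpos)
    refine summable_congr fun ε => ?_
    rw [totalSize_eq, nu]
    ring
  constructor
  · rintro ⟨⟨h1, h2⟩, h3⟩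
    have hα := fun k => (h1 k).1
    have hZ := (summable_weight_iff hα).1 h2
    exact ⟨hα, hZ, (key hα hZ).1 h3⟩
  · rintro ⟨hα, hZ, h⟩
    have hs := (summable_weight_iff hα).2 hZ
    exact ⟨⟨fun k => ⟨hα k, lt_one_of_summable_weight hs k⟩, hs⟩, (key hα hZ).2 h⟩

lemma half_shrink_le_half (ε : Excursion) : half (shrink ε) ≤ half ε :=
  (half_shrink_le ε).trans (Nat.sub_le _ _)

lemma shift_mem_paramSetPlus {α : ℕ+ → ℝ} (hα : α ∈ paramSetPlus) : shift α ∈ paramSetPlus := by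
  have h1 := (hα.1.1 1).2
  obtain ⟨h0, hZ, hM⟩ := mem_paramSetPlus_iff.1 hα
  have hg : ENNReal.ofReal (1 - α 1)⁻¹ ≠ 0 :=
    (ENNReal.ofReal_pos.2 (inv_pos.2 (by linarith))).ne'
  have fin : ∀ F : Excursion → ℝ≥0∞, weightedSum α (fun ε => F (shrink ε)) ≠ ∞ →
      weightedSum (shift α) F ≠ ∞ := by
    intro F hF h
    rw [weightedSum_comp_shrink h0 h1, h, ENNReal.mul_top hg] at hF
    exact hF rfl
  refine mem_paramSetPlus_iff.2 ⟨fun k => div_nonneg (h0 _) (pow_nonneg (by linarith) _),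
    fin 1 hZ, fin _ (ne_top_of_le_ne_top hM (weightedSum_mono α fun ε => ?_))⟩
  exact_mod_cast half_shrink_le_half ε

lemma iterate_shift_mem_paramSetPlus {α : ℕ+ → ℝ} (hα : α ∈ paramSetPlus) (l : ℕ) :
    shift^[l] α ∈ paramSetPlus := by
  induction l with
  | zero => exact hα
  | succ l ih => rw [Function.iterate_succ_apply']; exact shift_mem_paramSetPlus ih

/-! ### Expectations -/

/-- The expectation of `F` under `ν_α`. -/
def expect (α : ℕ+ → ℝ) (F : Excursion → ℝ≥0∞) : ℝ :=
  (weightedSum α F).toReal / (weightedSum α 1).toReal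

lemma meanLength_eq {α : ℕ+ → ℝ} (hα : ∀ k, 0 ≤ α k) :
    meanLength α = 1 + 2 * expect α (fun ε => (half ε : ℝ≥0∞)) := by
  rw [meanLength, expect, toReal_weightedSum_natCast hα, ← partitionFn_eq hα, div_eq_mul_inv,
    ← tsum_mul_right]
  congr 2
  refine tsum_congr fun ε => ?_
  rw [totalSize_eq, nu]
  ring

lemma one_le_meanLength {α : ℕ+ → ℝ} (hα : ∀ k, 0 ≤ α k) : 1 ≤ meanLength α := by
  rw [meanLength_eq hα, expect]
  have : 0 ≤ (weightedSum α (fun ε => (half ε : ℝ≥0∞))).toReal / (weightedSum α 1).toReal := by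
    positivity
  linarith

lemma toReal_weightedSum_one_pos {α : ℕ+ → ℝ} (hZ : weightedSum α 1 ≠ ∞) :
    0 < (weightedSum α 1).toReal :=
  ENNReal.toReal_pos (zero_lt_one.trans_le (one_le_weightedSum_one α)).ne' hZ

lemma toReal_weightedSum_comp_shrink {α : ℕ+ → ℝ} (hα : ∀ k, 0 ≤ α k) (h1 : α 1 < 1)
    (F : Excursion → ℝ≥0∞) :
    (weightedSum α (fun ε => F (shrink ε))).toReal
      = (1 - α 1)⁻¹ * (weightedSum (shift α) F).toReal := by
  rw [weightedSum_comp_shrink hα h1, ENNReal.toReal_mul,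
    ENNReal.toReal_ofReal (inv_nonneg.2 (by linarith))]

lemma toReal_weightedSum_one {α : ℕ+ → ℝ} (hα : ∀ k, 0 ≤ α k) (h1 : α 1 < 1) :
    (weightedSum α 1).toReal = (1 - α 1)⁻¹ * (weightedSum (shift α) 1).toReal :=
  toReal_weightedSum_comp_shrink hα h1 1

lemma expect_comp_shrink {α : ℕ+ → ℝ} (hα : ∀ k, 0 ≤ α k) (h1 : α 1 < 1)
    (F : Excursion → ℝ≥0∞) : expect α (fun ε => F (shrink ε)) = expect (shift α) F := by
  rw [expect, expect, toReal_weightedSum_comp_shrink hα h1, toReal_weightedSum_one hα h1]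
  exact mul_div_mul_left _ _ (inv_ne_zero (by linarith))

lemma expect_add {α : ℕ+ → ℝ} {F G : Excursion → ℝ≥0∞} (hF : weightedSum α F ≠ ∞)
    (hG : weightedSum α G ≠ ∞) : expect α (fun ε => F ε + G ε) = expect α F + expect α G := by
  rw [expect, weightedSum_add, ENNReal.toReal_add hF hG, add_div]
  rfl

lemma weightedSum_natCast_ne_top {α : ℕ+ → ℝ} (hα : α ∈ paramSetPlus) {f : Excursion → ℕ}
    (hf : ∀ ε, f ε ≤ half ε) : weightedSum α (fun ε => (f ε : ℝ≥0∞)) ≠ ∞ :=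
  ne_top_of_le_ne_top (mem_paramSetPlus_iff.1 hα).2.2
    (weightedSum_mono α fun ε => by exact_mod_cast hf ε)

lemma meanLength_eq_expect_length {α : ℕ+ → ℝ} (hα : α ∈ paramSetPlus) :
    meanLength α = expect α (fun ε => 2 * (half ε : ℝ≥0∞) + 1) := by
  obtain ⟨h0, hZ, hM⟩ := mem_paramSetPlus_iff.1 hα
  have hZ' := toReal_weightedSum_one_pos hZ
  have h := expect_add (F := fun ε => 2 * (half ε : ℝ≥0∞)) (G := 1)
    (by rw [weightedSum_const_mul]; finiteness) hZ
  simp only [Pi.one_apply] at h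
  rw [meanLength_eq h0, h, expect, expect, expect, weightedSum_const_mul, ENNReal.toReal_mul,
    div_self hZ'.ne', ENNReal.toReal_ofNat]
  ring

lemma expect_zeta_one {α : ℕ+ → ℝ} (hα : α ∈ paramSetPlus) :
    expect α (fun ε => (zeta ε 1 : ℝ≥0∞)) = α 1 / (1 - α 1) * meanLength (shift α) := by
  have h1 := (hα.1.1 1).2
  have h0 := (mem_paramSetPlus_iff.1 hα).1
  have h2 : 0 < 1 - α 1 := by linarith
  rw [meanLength_eq_expect_length (shift_mem_paramSetPlus hα), expect, expect,
    weightedSum_zeta_one h0 h1, ENNReal.toReal_mul,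
    ENNReal.toReal_ofReal (div_nonneg (h0 1) (by positivity)), toReal_weightedSum_one h0 h1]
  field_simp

lemma meanLength_sub {α : ℕ+ → ℝ} (hα : α ∈ paramSetPlus) :
    meanLength α = meanLength (shift α) + 2 * expect α (fun ε => (seatCount ε 1 : ℝ≥0∞)) := by
  have h1 := (hα.1.1 1).2
  have h0 := (mem_paramSetPlus_iff.1 hα).1
  have h0' := (mem_paramSetPlus_iff.1 (shift_mem_paramSetPlus hα)).1
  rw [meanLength_eq h0, meanLength_eq h0', ← expect_comp_shrink h0 h1]
  have h : (fun ε => (half ε : ℝ≥0∞))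
      = fun ε => (seatCount ε 1 : ℝ≥0∞) + (half (shrink ε) : ℝ≥0∞) := by
    funext ε
    exact_mod_cast half_eq ε
  conv_lhs => rw [h]
  rw [expect_add (weightedSum_natCast_ne_top hα fun ε => by have := half_eq ε; omega)
    (weightedSum_natCast_ne_top hα half_shrink_le_half)]
  ring

lemma meanLength_shift_le {α : ℕ+ → ℝ} (hα : α ∈ paramSetPlus) :
    meanLength (shift α) ≤ meanLength α := by
  rw [meanLength_sub hα, expect]
  have : 0 ≤ (weightedSum α (fun ε => (seatCount ε 1 : ℝ≥0∞))).toReal / (weightedSum α 1).toReal := by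
    positivity
  linarith

lemma meanLength_recurrence {α : ℕ+ → ℝ} (hα : α ∈ paramSetPlus) :
    meanLength α = 2 / (1 - α 1) * meanLength (shift α) - meanLength (shift (shift α)) := by
  have h1 := (hα.1.1 1).2
  have h0 := (mem_paramSetPlus_iff.1 hα).1
  have h2 : 1 - α 1 ≠ 0 := by linarith
  have e1 := meanLength_sub hα
  have e2 := meanLength_sub (shift_mem_paramSetPlus hα)
  have h : (fun ε => (seatCount ε 1 : ℝ≥0∞))
      = fun ε => (zeta ε 1 : ℝ≥0∞) + (seatCount (shrink ε) 1 : ℝ≥0∞) := by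
    funext ε
    exact_mod_cast seatCount_one_eq ε
  have e3 : expect α (fun ε => (seatCount ε 1 : ℝ≥0∞))
      = α 1 / (1 - α 1) * meanLength (shift α)
        + expect (shift α) (fun ε => (seatCount ε 1 : ℝ≥0∞)) := by
    rw [← expect_zeta_one hα, ← expect_comp_shrink h0 h1]
    conv_lhs => rw [h]
    refine expect_add (weightedSum_natCast_ne_top hα fun ε => ?_)
      (weightedSum_natCast_ne_top hα fun ε => ?_)
    all_goals have := half_eq ε; have := seatCount_one_eq ε; omega
  have e4 : 2 / (1 - α 1) = 2 + 2 * (α 1 / (1 - α 1)) := by field_simp; ring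
  rw [e4]
  linarith

lemma expect_comp_iterate_shrink {α : ℕ+ → ℝ} (hα : α ∈ paramSetPlus) (F : Excursion → ℝ≥0∞)
    (l : ℕ) : expect α (fun ε => F (shrink^[l] ε)) = expect (shift^[l] α) F := by
  induction l generalizing α with
  | zero => rfl
  | succ l ih =>
    simp only [Function.iterate_succ_apply]
    rw [expect_comp_shrink (mem_paramSetPlus_iff.1 hα).1 (hα.1.1 1).2
      (fun ε => F (shrink^[l] ε)), ih (shift_mem_paramSetPlus hα)]

lemma half_iterate_shrink_le (ε : Excursion) (l : ℕ) : half (shrink^[l] ε) ≤ half ε - l := by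
  induction l with
  | zero => rfl
  | succ l ih =>
    rw [Function.iterate_succ_apply']
    have := half_shrink_le (shrink^[l] ε)
    omega

lemma tendsto_meanLength_iterate_shift {α : ℕ+ → ℝ} (hα : α ∈ paramSetPlus) :
    Tendsto (fun l => meanLength (shift^[l] α)) atTop (𝓝 1) := by
  obtain ⟨h0, hZ, hM⟩ := mem_paramSetPlus_iff.1 hα
  have h : ∀ l, meanLength (shift^[l] α)
      = 1 + 2 * ((∑' ε, weight α ε * (half (shrink^[l] ε) : ℝ)) / (weightedSum α 1).toReal) := by
    intro l
    rw [meanLength_eq (mem_paramSetPlus_iff.1 (iterate_shift_mem_paramSetPlus hα l)).1,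
      ← expect_comp_iterate_shrink hα, expect,
      toReal_weightedSum_natCast h0 fun ε => half (shrink^[l] ε)]
  simp only [h]
  have hlim : Tendsto (fun l => ∑' ε, weight α ε * (half (shrink^[l] ε) : ℝ)) atTop
      (𝓝 (∑' _ : Excursion, 0)) := by
    refine tendsto_tsum_of_dominated_convergence ((summable_weight_mul_iff h0 half).2 hM)
      (fun ε => ?_) (Eventually.of_forall fun l ε => ?_)
    · refine tendsto_const_nhds.congr' ?_
      filter_upwards [eventually_ge_atTop (half ε)] with l hl
      have := half_iterate_shrink_le ε l
      rw [show half (shrink^[l] ε) = 0 by omega]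
      simp
    · rw [Real.norm_of_nonneg (mul_nonneg (weight_nonneg h0 ε) (Nat.cast_nonneg _))]
      refine mul_le_mul_of_nonneg_left ?_ (weight_nonneg h0 ε)
      exact_mod_cast (half_iterate_shrink_le ε l).trans (Nat.sub_le _ _)
  simpa using ((hlim.div_const (weightedSum α 1).toReal).const_mul 2).const_add 1

/-! ### The continued fraction -/

lemma convergent_sub_mem {α : ℕ+ → ℝ} {R : ℕ → ℝ} (h1 : ∀ l, 1 ≤ R l)
    (hR : ∀ l, R l = 2 / (1 - (shift^[l] α) 1) - 1 / R (l + 1)) (n l : ℕ) :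
    0 ≤ convergent n (shift^[l] α) - R l ∧
      convergent n (shift^[l] α) - R l ≤ 1 / ((n : ℝ) + 1) := by
  induction n generalizing l with
  | zero =>
    have hpos : 0 < R (l + 1) := zero_lt_one.trans_le (h1 _)
    have e : convergent 0 (shift^[l] α) - R l = 1 / R (l + 1) := by rw [convergent, hR l]; ring
    rw [e]
    refine ⟨by positivity, ?_⟩
    rw [div_le_div_iff₀ hpos (by norm_num)]
    simpa using h1 (l + 1)
  | succ n ih =>
    obtain ⟨h2, h3⟩ := ih (l + 1)
    rw [Function.iterate_succ_apply'] at h2 h3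
    have h4 := h1 (l + 1)
    set c := convergent n (shift (shift^[l] α)) with hc
    have e : convergent (n + 1) (shift^[l] α) - R l = 1 / R (l + 1) - 1 / c := by
      rw [convergent, hR l]; ring
    rw [e]
    have hpos : 0 < R (l + 1) := by linarith
    have hcpos : 0 < c := by linarith
    have hn : (0 : ℝ) ≤ n := Nat.cast_nonneg n
    constructor
    · rw [sub_nonneg]
      exact one_div_le_one_div_of_le hpos (by linarith)
    · rw [div_sub_div _ _ hpos.ne' hcpos.ne', div_le_div_iff₀ (by positivity) (by positivity)]
      rw [le_div_iff₀ (by positivity)] at h3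
      push_cast
      nlinarith [mul_nonneg (sub_nonneg.2 h4) hcpos.le]

lemma tendsto_convergent {α : ℕ+ → ℝ} {R : ℕ → ℝ} (h1 : ∀ l, 1 ≤ R l)
    (hR : ∀ l, R l = 2 / (1 - (shift^[l] α) 1) - 1 / R (l + 1)) (l : ℕ) :
    Tendsto (fun n => convergent n (shift^[l] α)) atTop (𝓝 (R l)) := by
  rw [← tendsto_sub_nhds_zero_iff]
  exact squeeze_zero (fun n => (convergent_sub_mem h1 hR n l).1)
    (fun n => (convergent_sub_mem h1 hR n l).2) tendsto_one_div_add_atTop_nhds_zero_nat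

lemma prod_range_div_succ {M : ℕ → ℝ} (hM : ∀ l, M l ≠ 0) (N : ℕ) :
    ∏ l ∈ Finset.range N, M l / M (l + 1) = M 0 / M N := by
  induction N with
  | zero => simp [hM]
  | succ N ih => rw [Finset.prod_range_succ, ih, div_mul_div_cancel₀ (hM N)]

end BoxBall

end

theorem mainTheorem10 (α : ℕ+ → ℝ) (hα : α ∈ BoxBall.paramSetPlus) :
    (∀ l : ℕ, BoxBall.shift^[l] α ∈ BoxBall.paramSetPlus ∧
      Tendsto (fun n => BoxBall.convergent n (BoxBall.shift^[l] α)) atTop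
        (𝓝 (BoxBall.contFrac (BoxBall.shift^[l] α)))) ∧
    Tendsto (fun N : ℕ => ∏ l ∈ Finset.range N, BoxBall.contFrac (BoxBall.shift^[l] α)) atTop
      (𝓝 (BoxBall.meanLength α)) := by
  have hmem := BoxBall.iterate_shift_mem_paramSetPlus hα
  set M : ℕ → ℝ := fun l => BoxBall.meanLength (BoxBall.shift^[l] α) with hM
  have hM1 : ∀ l, 1 ≤ M l := fun l => BoxBall.one_le_meanLength fun k => ((hmem l).1.1 k).1
  have hM0 : ∀ l, 0 < M l := fun l => zero_lt_one.trans_le (hM1 l)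
  have hR1 : ∀ l, 1 ≤ M l / M (l + 1) := fun l => by
    rw [one_le_div (hM0 _)]
    simp only [hM, Function.iterate_succ_apply']
    exact BoxBall.meanLength_shift_le (hmem l)
  have hR : ∀ l, M l / M (l + 1)
      = 2 / (1 - (BoxBall.shift^[l] α) 1) - 1 / (M (l + 1) / M (l + 1 + 1)) := fun l => by
    have h : M l = 2 / (1 - (BoxBall.shift^[l] α) 1) * M (l + 1) - M (l + 1 + 1) := by
      simp only [hM, Function.iterate_succ_apply']
      exact BoxBall.meanLength_recurrence (hmem l)
    rw [one_div_div, h, sub_div, mul_div_cancel_right₀ _ (hM0 _).ne']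
  have hconv := BoxBall.tendsto_convergent hR1 hR
  have hlim : ∀ l, BoxBall.contFrac (BoxBall.shift^[l] α) = M l / M (l + 1) :=
    fun l => (hconv l).limUnder_eq
  refine ⟨fun l => ⟨hmem l, by rw [hlim]; exact hconv l⟩, ?_⟩
  simp only [hlim, BoxBall.prod_range_div_succ fun l => (hM0 l).ne']
  have h : Tendsto (fun N => M 0 / M N) atTop (𝓝 (M 0 / 1)) :=
    tendsto_const_nhds.div (BoxBall.tendsto_meanLength_iterate_shift hα) one_ne_zero
  rwa [div_one] at h
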